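/- **Theorem 1.1 (General distributions).** For $\lambda>0$ let $\Phi_\lambda:\mathbb R\to\mathbb R$, $\Phi_\lambda(x)=\max(-\lambda,\min(x,\lambda))$, be the clipping operator. Write $\mathbf S^{n-1}$ and $\mathbf B_{\mathbb R^n}$ for the unit sphere and the closed unit ball of $\mathbb R^n$ with the Euclidean norm $\|\cdot\|_2$. Let $\mathcal V$ be a set of random vectors in Euclidean spaces (possibly of different dimensions) such that the following two conditions hold. (i) For every $\varepsilon>0$ there is $\delta>0$ such that, for all $n$ and every $X\in\mathcal V$ that is a random vector in $\mathbb R^n$, $$\sup_{v\in\mathbf S^{n-1}}\mathbb P\big(|\langle X,v\rangle|\le\delta\big)\le\varepsilon .$$ (ii) For every $\delta>0$ there is $\tilde\varepsilon>0$ such that, for all $n$ and every $X\in\mathcal V$ that is a random vector in $\mathbb R^n$, $$\inf_{u\in\mathbf S^{n-1}}\mathbb P\big(|\langle X,u\rangle|\le\delta\big)\ge\tilde\varepsilon .$$ Then for every $\lambda>0$ there are constants $C(\lambda),c(\lambda)>0$, depending only on $\lambda$ and $\mathcal V$, such that the following holds. Let $X\in\mathcal V$ be a random vector in $\mathbb R^n$,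 let $m\ge C(\lambda)\,n$, and let $X_1,\dots,X_m$ be i.i.d. copies of $X$. Then, with probability at least $1-e^{-c(\lambda)m}$, the inequality $$\frac1m\sum_{i=1}^m\big|\Phi_\lambda(\langle X_i,u\rangle)-\Phi_\lambda(\langle X_i,v\rangle)\big|^2\ \ge\ c(\lambda)\,\|u-v\|_2^2$$ holds simultaneously for all $u,v\in\mathbf B_{\mathbb R^n}$. -/

import Mathlib

open MeasureTheory ProbabilityTheory
open scoped RealInnerProductSpace
universe u v


/-- A random vector in some Euclidean space `ℝ^dim`: a measurable map from a probability space
to `ℝ^dim`. The dimension is part of the data, so that a set of random vectors may contain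
vectors of different dimensions. -/
structure RandomVector : Type (u + 1) where
  /-- the dimension of the Euclidean space in which the vector takes its values -/
  dim : ℕ
  /-- the underlying sample space -/
  Ω : Type u
  [measurableSpace : MeasurableSpace Ω]
  /-- the probability on the sample space -/
  prob : Measure Ω
  [isProbabilityMeasure : IsProbabilityMeasure prob]
  /-- the vector as a function on the sample space -/
  toFun : Ω → EuclideanSpace ℝ (Fin dim)
  measurable_toFun : Measurable toFun

attribute [instance] RandomVector.measurableSpace RandomVector.isProbabilityMeasure

/-- The strong small-ball condition, uniform over the set `V`: for every `ε > 0` there is `δ > 0`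
such that `ℙ(|⟨X, v⟩| ≤ δ) ≤ ε` for all `X ∈ V` and all unit vectors `v`. -/
def StrongSmallBall (V : Set RandomVector.{u}) : Prop :=
  ∀ ε : ℝ, 0 < ε → ∃ δ : ℝ, 0 < δ ∧ ∀ X ∈ V,
    ∀ v ∈ Metric.sphere (0 : EuclideanSpace ℝ (Fin X.dim)) 1,
      X.prob.real {ω | |⟪X.toFun ω, v⟫| ≤ δ} ≤ ε

/-- The reverse small-ball condition, uniform over the set `V`: for every `δ > 0` there is `ε > 0`
such that `ℙ(|⟨X, u⟩| ≤ δ) ≥ ε` for all `X ∈ V` and all unit vectors `u`. -/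
def ReverseSmallBall (V : Set RandomVector.{u}) : Prop :=
  ∀ δ : ℝ, 0 < δ → ∃ ε : ℝ, 0 < ε ∧ ∀ X ∈ V,
    ∀ u ∈ Metric.sphere (0 : EuclideanSpace ℝ (Fin X.dim)) 1,
      ε ≤ X.prob.real {ω | |⟪X.toFun ω, u⟫| ≤ δ}

/-- The clipping operator `Φ_lam(x) = -lam ∨ x ∧ lam` at the threshold `lam`. -/
noncomputable def clip (lam x : ℝ) : ℝ := max (-lam) (min x lam)

/-!
The argument needs no moments of `X`; it rests on a one-sided Vapnik–Chervonenkis bound.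

If `|⟪x, u⟫| ≤ lam / 2` and `|⟪x, w⟫| > b`, where `w` is the direction of `u - v`, then clipping
preserves the difference of `⟪x, u⟫` and `⟪x, v⟫` up to a constant multiple of `‖u - v‖`, whatever
`⟪x, v⟫` is (`mul_norm_sub_le_abs_clip_sub_clip`). The reverse small-ball condition gives the first
inequality with some probability `ε`, and the small-ball condition, applied at the level `ε / 2`,
gives both together with probability at least `p = ε / 2` (`le_measureReal_slabDiff`). It remains to
show that, outside an event of exponentially small probability, every set
`slabDiff a b (u, w) = {x | |⟪x, u⟫| ≤ a ∧ b < |⟪x, w⟫|}` contains a fixed proportion of the sample.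

Half-spaces in dimension `n` have Vapnik–Chervonenkis dimension at most `n + 1` by Radon's theorem,
so by the Sauer–Shelah lemma the sets `slabDiff a b t` have few traces on `2 * m` points: at most
`exp (η * m)` for any prescribed `η > 0` once `m` is at least a constant multiple of `n`. An
exponential symmetrization with an independent second sample (`lintegral_iSup_exp_hitGap_le`) then
allows a union bound over traces. With `#x` and `#y` the numbers of points of the two samples in
the set `A t`, the mean of `⨆ t, exp (s * (#y - #x))` is at most the number of traces times
`exp (s ^ 2 * m / 2)`, while a sample `x` with `#x ≤ p * m / 2` for some `t` makes the mean over `y`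
at least `exp (s * p * m / 2)` by Jensen's inequality (`measure_exists_hits_le`).

All suprema are taken over a countable dense set of parameters, which keeps them measurable; the
passage to all parameters costs a factor `2` in the thresholds
(`exists_mem_dense_slabDiff_subset`).
-/

/-! ### Clipping -/

theorem min_le_abs_clip_sub_clip {lam a b : ℝ} (hlam : 0 < lam) (ha : |a| ≤ lam / 2) :
    min |a - b| (lam / 2) ≤ |clip lam a - clip lam b| := by
  obtain ⟨h1, h2⟩ := abs_le.1 ha
  have hca : clip lam a = a := by
    rw [clip, min_eq_left (by linarith), max_eq_right (by linarith)]
  rw [hca]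
  rcases lt_or_ge lam b with hb | hb
  · have : clip lam b = lam := by rw [clip, min_eq_right hb.le, max_eq_right (by linarith)]
    rw [this, abs_sub_comm a lam]
    exact (min_le_right _ _).trans ((by linarith : _ ≤ lam - a).trans (le_abs_self _))
  rcases lt_or_ge b (-lam) with hb' | hb'
  · have : clip lam b = -lam := by rw [clip, min_eq_left hb, max_eq_left hb'.le]
    rw [this]
    exact (min_le_right _ _).trans ((by linarith : _ ≤ a - -lam).trans (le_abs_self _))
  · have : clip lam b = b := by rw [clip, min_eq_left hb, max_eq_right hb']
    rw [this]
    exact min_le_left _ _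

/-! ### Counting the traces of half-spaces and slabs -/

/-- The binomial sum of the Sauer–Shelah lemma is at most `exp (d * log x⁻¹ + x * N)` for every
`x ∈ (0, 1]`, because `∑ k ≤ d, N.choose k ≤ x⁻¹ ^ d * (1 + x) ^ N`. -/
theorem sum_choose_le_exp {x : ℝ} (hx : 0 < x) (hx1 : x ≤ 1) (N d : ℕ) :
    ((∑ k ∈ Finset.Iic d, N.choose k : ℕ) : ℝ) ≤ Real.exp (d * Real.log x⁻¹ + x * N) := by
  have hexp : Real.exp (d * Real.log x⁻¹) = x⁻¹ ^ d := by
    rw [mul_comm, Real.exp_mul, Real.exp_log (inv_pos.2 hx), Real.rpow_natCast]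
  have hbinom : ∑ k ∈ Finset.Iic d, x ^ k * (N.choose k : ℝ) ≤ (x + 1) ^ N := by
    rw [add_pow]
    simp only [one_pow, mul_one]
    calc ∑ k ∈ Finset.Iic d, x ^ k * (N.choose k : ℝ)
        ≤ ∑ k ∈ Finset.range (N + 1) ∪ Finset.Iic d, x ^ k * (N.choose k : ℝ) :=
          Finset.sum_le_sum_of_subset_of_nonneg Finset.subset_union_right
            fun _ _ _ => by positivity
      _ = ∑ k ∈ Finset.range (N + 1), x ^ k * (N.choose k : ℝ) := by
          refine (Finset.sum_subset Finset.subset_union_left fun k _ hk => ?_).symm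
          rw [Nat.choose_eq_zero_of_lt (by simpa using hk)]
          simp
  calc ((∑ k ∈ Finset.Iic d, N.choose k : ℕ) : ℝ)
      ≤ ∑ k ∈ Finset.Iic d, x⁻¹ ^ d * (x ^ k * (N.choose k : ℝ)) := by
        push_cast
        refine Finset.sum_le_sum fun k hk => ?_
        rw [← mul_assoc]
        refine le_mul_of_one_le_left (by positivity) ?_
        rw [inv_pow, ← div_eq_inv_mul, one_le_div (by positivity)]
        exact pow_le_pow_of_le_one hx.le hx1 (Finset.mem_Iic.1 hk)
    _ ≤ x⁻¹ ^ d * (x + 1) ^ N := by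
        rw [← Finset.mul_sum]; gcongr
    _ ≤ x⁻¹ ^ d * Real.exp x ^ N := by
        gcongr; exact Real.add_one_le_exp x
    _ = _ := by rw [Real.exp_add, hexp, ← Real.exp_nat_mul, mul_comm x]

section Traces

variable {E κ : Type*} [NormedAddCommGroup E] [InnerProductSpace ℝ E] [Fintype κ]

open Classical in
/-- The family of all subsets of `κ` that are cut out of the points `z j` by a closed half-space
`{x | ⟪x, u⟫ ≤ τ}` with the fixed offset `τ`; the normal `u` is any vector, possibly zero. -/
noncomputable def halfspaceTraces (z : κ → E) (τ : ℝ) : Finset (Finset κ) :=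
  {B | ∃ u : E, ∀ j, j ∈ B ↔ ⟪z j, u⟫ ≤ τ}

theorem mem_halfspaceTraces {z : κ → E} {τ : ℝ} {B : Finset κ} :
    B ∈ halfspaceTraces z τ ↔ ∃ u : E, ∀ j, j ∈ B ↔ ⟪z j, u⟫ ≤ τ := by
  simp [halfspaceTraces]

/-- By Radon's theorem, half-spaces cannot shatter more than `finrank ℝ E + 1` points. -/
theorem vcDim_halfspaceTraces_le [DecidableEq κ] [FiniteDimensional ℝ E] (z : κ → E) (τ : ℝ) :
    (halfspaceTraces z τ).vcDim ≤ Module.finrank ℝ E + 1 := by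
  refine Finset.sup_le fun s hs => ?_
  rw [Finset.mem_shatterer] at hs
  by_contra! hcard
  have hdep : ¬ AffineIndependent ℝ (fun j : s => z j) := fun h => by
    have h1 := h.card_le_finrank_succ
    have h2 := Submodule.finrank_le (vectorSpan ℝ (Set.range fun j : s => z j))
    rw [Fintype.card_coe] at h1
    omega
  obtain ⟨I, p, hpI, hpIc⟩ := Convex.radon_partition hdep
  classical
  obtain ⟨B, hB, hsB⟩ := hs (Finset.filter_subset (fun j => ∃ h : j ∈ s, (⟨j, h⟩ : s) ∈ I) s)
  obtain ⟨u, hu⟩ := mem_halfspaceTraces.1 hB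
  have hmem : ∀ j : s, j ∈ I ↔ ⟪z j, u⟫ ≤ τ := fun j => by
    rw [← hu]
    have := congrArg ((j : κ) ∈ ·) hsB
    simpa using this.symm
  have h1 : convexHull ℝ ((fun j : s => z j) '' I) ⊆ {x | ⟪u, x⟫ ≤ τ} := by
    refine convexHull_min ?_ (convex_halfSpace_le (innerₛₗ ℝ u).isLinear τ)
    rintro _ ⟨j, hj, rfl⟩
    exact (real_inner_comm _ _).trans_le ((hmem j).1 hj)
  have h2 : convexHull ℝ ((fun j : s => z j) '' Iᶜ) ⊆ {x | τ < ⟪u, x⟫} := by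
    refine convexHull_min ?_ (convex_halfSpace_gt (innerₛₗ ℝ u).isLinear τ)
    rintro _ ⟨j, hj, rfl⟩
    have := (hmem j).not.1 hj
    rw [real_inner_comm, not_le] at this
    exact this
  exact (lt_irrefl τ) ((show τ < ⟪u, p⟫ from h2 hpIc).trans_le (h1 hpI))

theorem card_halfspaceTraces_le [FiniteDimensional ℝ E] (z : κ → E) (τ : ℝ) :
    (halfspaceTraces z τ).card ≤
      ∑ k ∈ Finset.Iic (Module.finrank ℝ E + 1), (Fintype.card κ).choose k := by
  classical
  exact (Finset.card_le_card_shatterer _).trans <| Finset.card_shatterer_le_sum_vcDim.trans <|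
    Finset.sum_le_sum_of_subset (Finset.Iic_subset_Iic.2 (vcDim_halfspaceTraces_le z τ))

/-- The slab `|⟪x, u⟫| ≤ a` with the slab `|⟪x, w⟫| ≤ b` removed. -/
def slabDiff (a b : ℝ) (t : E × E) : Set E := {x | |⟪x, t.1⟫| ≤ a ∧ b < |⟪x, t.2⟫|}

/-- Each slab is an intersection of two half-spaces, so a trace of `slabDiff` is determined by four
traces of half-spaces. -/
theorem exists_slabDiff_traces [FiniteDimensional ℝ E] (a b : ℝ) (z : κ → E) :
    ∃ 𝒯 : Finset (Finset κ),
      𝒯.card ≤ (∑ k ∈ Finset.Iic (Module.finrank ℝ E + 1), (Fintype.card κ).choose k) ^ 4 ∧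
      ∀ t : E × E, ∃ B ∈ 𝒯, ∀ j, j ∈ B ↔ z j ∈ slabDiff a b t := by
  classical
  let H := halfspaceTraces z
  have hH : ∀ (τ : ℝ) (u : E), ∃ B ∈ H τ, ∀ j, j ∈ B ↔ ⟪z j, u⟫ ≤ τ := fun τ u =>
    ⟨Finset.univ.filter fun j => ⟪z j, u⟫ ≤ τ, mem_halfspaceTraces.2 ⟨u, by simp⟩, by simp⟩
  refine ⟨((H a ×ˢ H a) ×ˢ (H b ×ˢ H b)).image
    fun q => (q.1.1 ∩ q.1.2) \ (q.2.1 ∩ q.2.2), ?_, fun t => ?_⟩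
  · refine Finset.card_image_le.trans ?_
    rw [Finset.card_product, Finset.card_product, Finset.card_product]
    calc _ ≤ _ := Nat.mul_le_mul
          (Nat.mul_le_mul (card_halfspaceTraces_le z a) (card_halfspaceTraces_le z a))
          (Nat.mul_le_mul (card_halfspaceTraces_le z b) (card_halfspaceTraces_le z b))
      _ = _ := by ring
  · obtain ⟨B₁, h₁, e₁⟩ := hH a t.1
    obtain ⟨B₂, h₂, e₂⟩ := hH a (-t.1)
    obtain ⟨B₃, h₃, e₃⟩ := hH b t.2
    obtain ⟨B₄, h₄, e₄⟩ := hH b (-t.2)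
    refine ⟨(B₁ ∩ B₂) \ (B₃ ∩ B₄), Finset.mem_image.2 ⟨((B₁, B₂), (B₃, B₄)), ?_, rfl⟩, fun j => ?_⟩
    · simp [h₁, h₂, h₃, h₄]
    · have habs : ∀ (u : E) (τ : ℝ), |⟪z j, u⟫| ≤ τ ↔ ⟪z j, u⟫ ≤ τ ∧ ⟪z j, -u⟫ ≤ τ := fun u τ => by
        rw [abs_le', inner_neg_right]
      simp only [Finset.mem_sdiff, Finset.mem_inter, e₁, e₂, e₃, e₄, ← habs, slabDiff,
        Set.mem_ofPred_eq, not_le]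

end Traces

/-! ### Uniform lower tails by symmetrization -/

section Symmetrization

variable {E ι T : Type*} [Fintype ι]

/-- The number of points of the sample `x` that lie in `A`, as a real number. -/
noncomputable def hits (A : Set E) (x : ι → E) : ℝ := ∑ i, A.indicator 1 (x i)

/-- Interchanges the two entries of those pairs whose index `i` has `ε i = true`. -/
def swapPairs (ε : ι → Bool) (z : ι → E × E) : ι → E × E :=
  fun i => if ε i then (z i).swap else z i

/-- The number of second entries of `z` in `A` minus the number of first entries in `A`. -/
noncomputable def hitGap (A : Set E) (z : ι → E × E) : ℝ :=
  hits A (fun i => (z i).2) - hits A (fun i => (z i).1)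

theorem hits_nonneg (A : Set E) (x : ι → E) : 0 ≤ hits A x :=
  Finset.sum_nonneg fun _ _ => Set.indicator_nonneg (by simp) _

theorem hits_le_card (A : Set E) (x : ι → E) : hits A x ≤ Fintype.card ι := by
  calc hits A x ≤ ∑ _i : ι, (1 : ℝ) :=
        Finset.sum_le_sum fun i _ => Set.indicator_le_self' (by simp) _
    _ = _ := by simp

theorem hits_mono {A B : Set E} {x : ι → E} (h : ∀ i, x i ∈ A → x i ∈ B) :
    hits A x ≤ hits B x := by
  refine Finset.sum_le_sum fun i _ => ?_
  by_cases hA : x i ∈ A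
  · simp [hA, h i hA]
  · rw [Set.indicator_of_notMem hA]
    exact Set.indicator_nonneg (by simp) _

/-- The average over all swaps of `exp (s * hitGap)` is a product of hyperbolic cosines. -/
theorem sum_exp_hitGap_swapPairs_le [DecidableEq ι] (A : Set E) (s : ℝ) (z : ι → E × E) :
    ∑ ε : ι → Bool, Real.exp (s * hitGap A (swapPairs ε z)) ≤
      2 ^ Fintype.card ι * Real.exp (s ^ 2 / 2 * Fintype.card ι) := by
  set d : ι → ℝ := fun i => A.indicator 1 (z i).2 - A.indicator 1 (z i).1
  have hd : ∀ i, d i ^ 2 ≤ 1 := fun i => by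
    by_cases h₁ : (z i).1 ∈ A <;> by_cases h₂ : (z i).2 ∈ A <;> simp [d, h₁, h₂]
  have hgap : ∀ ε : ι → Bool, s * hitGap A (swapPairs ε z) =
      ∑ i, if ε i then -(s * d i) else s * d i := fun ε => by
    rw [hitGap, hits, hits, ← Finset.sum_sub_distrib, Finset.mul_sum]
    refine Finset.sum_congr rfl fun i _ => ?_
    simp only [swapPairs, d]
    split_ifs <;> simp
    ring
  calc ∑ ε : ι → Bool, Real.exp (s * hitGap A (swapPairs ε z))
      = ∏ i, ∑ b : Bool, Real.exp (if b then -(s * d i) else s * d i) := by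
        rw [Finset.prod_univ_sum, Fintype.piFinset_univ]
        exact Finset.sum_congr rfl fun ε _ => by rw [hgap, Real.exp_sum]
    _ = ∏ i, 2 * Real.cosh (s * d i) := by
        refine Finset.prod_congr rfl fun i _ => ?_
        rw [Real.cosh_eq, Fintype.sum_bool]
        simp
        ring
    _ ≤ ∏ _i : ι, 2 * Real.exp (s ^ 2 / 2) := by
        refine Finset.prod_le_prod (fun i _ => by positivity) fun i _ => ?_
        gcongr
        refine (Real.cosh_le_exp_half_sq _).trans (Real.exp_le_exp.2 ?_)
        rw [mul_pow]
        nlinarith [sq_nonneg s, hd i]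
    _ = _ := by
        rw [Finset.prod_const, Finset.card_univ, mul_pow, ← Real.exp_nat_mul, mul_comm (s ^ 2 / 2)]

variable [MeasurableSpace E]

theorem measurable_hits {A : Set E} (hA : MeasurableSet A) :
    Measurable (hits A : (ι → E) → ℝ) := by
  unfold hits
  exact Finset.measurable_sum _ fun i _ =>
    (measurable_one.indicator hA).comp (measurable_pi_apply i)

theorem measurable_hitGap {A : Set E} (hA : MeasurableSet A) :
    Measurable (hitGap A : (ι → E × E) → ℝ) := by
  unfold hitGap
  exact ((measurable_hits hA).comp (by fun_prop)).sub ((measurable_hits hA).comp (by fun_prop))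

theorem integral_hits (μ : Measure E) [IsProbabilityMeasure μ] {A : Set E} (hA : MeasurableSet A) :
    ∫ x, hits A x ∂(Measure.pi fun _ : ι => μ) = Fintype.card ι * μ.real A := by
  have hmp : ∀ i : ι, MeasurePreserving (Function.eval i) (Measure.pi fun _ : ι => μ) μ :=
    fun i => measurePreserving_eval (fun _ : ι => μ) i
  have hint : Integrable (A.indicator (1 : E → ℝ)) μ := (integrable_const (1 : ℝ)).indicator hA
  unfold hits
  rw [integral_finsetSum]
  · have : ∀ i : ι, ∫ x : ι → E, A.indicator (1 : E → ℝ) (x i) ∂(Measure.pi fun _ : ι => μ)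
        = μ.real A := fun i => by
      rw [← integral_indicator_one hA]
      conv_rhs => rw [← (hmp i).map_eq]
      rw [integral_map (hmp i).measurable.aemeasurable
          (measurable_one.indicator hA).aestronglyMeasurable]
    simp [this]
  · exact fun i _ => (hmp i).integrable_comp_of_integrable hint

/-- Jensen's inequality for `exp`, by the tangent line at the mean of `s * hits A x`. -/
theorem exp_card_mul_le_integral_exp_hits (μ : Measure E) [IsProbabilityMeasure μ] {A : Set E}
    (hA : MeasurableSet A) (s : ℝ) :
    Real.exp (s * (Fintype.card ι * μ.real A)) ≤
      ∫ x, Real.exp (s * hits A x) ∂(Measure.pi fun _ : ι => μ) := by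
  set r := s * (Fintype.card ι * μ.real A) with hr
  have hmeas : Measurable (hits A : (ι → E) → ℝ) := measurable_hits hA
  have hint : Integrable (hits A : (ι → E) → ℝ) (Measure.pi fun _ : ι => μ) :=
    Integrable.of_bound hmeas.aestronglyMeasurable (Fintype.card ι) <| .of_forall fun x => by
      rw [Real.norm_of_nonneg (hits_nonneg A x)]; exact hits_le_card A x
  have hint' : Integrable (fun x : ι → E => Real.exp (s * hits A x))
      (Measure.pi fun _ : ι => μ) :=
    Integrable.of_bound (by fun_prop) (Real.exp (|s| * Fintype.card ι)) <| .of_forall fun x => by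
      rw [Real.norm_of_nonneg (Real.exp_nonneg _), Real.exp_le_exp]
      exact mul_le_mul (le_abs_self s) (hits_le_card A x) (hits_nonneg A x) (abs_nonneg s)
  have hlin : Integrable (fun x : ι → E => s * hits A x - r) (Measure.pi fun _ : ι => μ) :=
    (hint.const_mul s).sub (integrable_const r)
  calc Real.exp r
      = ∫ x, Real.exp r * (1 + (s * hits A x - r)) ∂(Measure.pi fun _ : ι => μ) := by
        rw [integral_const_mul, integral_add (integrable_const 1) hlin,
          integral_sub (hint.const_mul s) (integrable_const r), integral_const_mul,
          integral_hits μ hA]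
        simp [hr]
    _ ≤ _ := by
        refine integral_mono (((integrable_const 1).add hlin).const_mul _) hint' fun x => ?_
        calc Real.exp r * (1 + (s * hits A x - r))
            ≤ Real.exp r * Real.exp (s * hits A x - r) := by
              gcongr; linarith [Real.add_one_le_exp (s * hits A x - r)]
          _ = _ := by rw [← Real.exp_add]; congr 1; ring

theorem measurePreserving_swapPairs (μ : Measure E) [IsProbabilityMeasure μ] (ε : ι → Bool) :
    MeasurePreserving (swapPairs ε) (Measure.pi fun _ : ι => μ.prod μ)
      (Measure.pi fun _ : ι => μ.prod μ) := by
  refine measurePreserving_pi (f := fun i (p : E × E) => if ε i then p.swap else p) _ _ fun i => ?_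
  cases ε i
  · exact MeasurePreserving.id _
  · simpa using Measure.measurePreserving_swap

/-- The number of traces on a double sample controls the mean of the largest `exp (s * hitGap)`:
randomly swapping the paired points does not change the mean, and after the swaps the traces are
handled one by one. -/
theorem lintegral_iSup_exp_hitGap_le [Countable T] (μ : Measure E) [IsProbabilityMeasure μ]
    {A : T → Set E} (hA : ∀ t, MeasurableSet (A t)) {S : ℕ}
    (hS : ∀ z : ι ⊕ ι → E, ∃ 𝒯 : Finset (Finset (ι ⊕ ι)), 𝒯.card ≤ S ∧
      ∀ t, ∃ B ∈ 𝒯, ∀ j, j ∈ B ↔ z j ∈ A t) (s : ℝ) :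
    ∫⁻ z, ⨆ t, ENNReal.ofReal (Real.exp (s * hitGap (A t) z)) ∂(Measure.pi fun _ : ι => μ.prod μ) ≤
      ENNReal.ofReal (S * Real.exp (s ^ 2 / 2 * Fintype.card ι)) := by
  classical
  set ν := Measure.pi fun _ : ι => μ.prod μ
  set F : (ι → E × E) → ENNReal := fun z => ⨆ t, ENNReal.ofReal (Real.exp (s * hitGap (A t) z))
  have hF : Measurable F := Measurable.iSup fun t =>
    (Real.measurable_exp.comp ((measurable_hitGap (hA t)).const_mul s)).ennreal_ofReal
  set M : ℝ := Real.exp (s ^ 2 / 2 * Fintype.card ι)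
  -- For fixed points, the supremum is at most a sum over the traces of the double sample.
  have hpt : ∀ z, ∑ ε : ι → Bool, F (swapPairs ε z) ≤
      2 ^ Fintype.card ι * ENNReal.ofReal (S * M) := fun z => by
    obtain ⟨𝒯, hcard, h𝒯⟩ := hS (Sum.elim (fun i => (z i).1) (fun i => (z i).2))
    let x : ι ⊕ ι → E := Sum.elim (fun i => (z i).1) (fun i => (z i).2)
    let p : ι → (ι ⊕ ι) × (ι ⊕ ι) := fun i => (Sum.inl i, Sum.inr i)
    have hle : ∀ ε : ι → Bool, F (swapPairs ε z) ≤
        ∑ B ∈ 𝒯, ENNReal.ofReal (Real.exp (s * hitGap (B : Set (ι ⊕ ι)) (swapPairs ε p))) := by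
      intro ε
      refine iSup_le fun t => ?_
      obtain ⟨B, hB, hBt⟩ := h𝒯 t
      have heq : hitGap (A t) (swapPairs ε z) = hitGap (B : Set (ι ⊕ ι)) (swapPairs ε p) := by
        have h1 : ∀ i, ((z i).1 ∈ A t ↔ Sum.inl i ∈ B) := fun i => (hBt (Sum.inl i)).symm
        have h2 : ∀ i, ((z i).2 ∈ A t ↔ Sum.inr i ∈ B) := fun i => (hBt (Sum.inr i)).symm
        simp only [hitGap, hits]
        congr 1 <;> refine Finset.sum_congr rfl fun i _ => ?_ <;>
          cases hε : ε i <;> simp [swapPairs, p, Set.indicator, hε, h1, h2]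
      rw [heq]
      exact Finset.single_le_sum
        (f := fun B : Finset (ι ⊕ ι) =>
          ENNReal.ofReal (Real.exp (s * hitGap (B : Set (ι ⊕ ι)) (swapPairs ε p))))
        (fun _ _ => zero_le) hB
    calc ∑ ε : ι → Bool, F (swapPairs ε z)
        ≤ ∑ ε : ι → Bool, ∑ B ∈ 𝒯,
            ENNReal.ofReal (Real.exp (s * hitGap (B : Set (ι ⊕ ι)) (swapPairs ε p))) :=
          Finset.sum_le_sum fun ε _ => hle ε
      _ = ∑ B ∈ 𝒯, ENNReal.ofReal
            (∑ ε : ι → Bool, Real.exp (s * hitGap (B : Set (ι ⊕ ι)) (swapPairs ε p))) := by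
          rw [Finset.sum_comm]
          exact Finset.sum_congr rfl fun B _ =>
            (ENNReal.ofReal_sum_of_nonneg fun _ _ => Real.exp_nonneg _).symm
      _ ≤ ∑ _B ∈ 𝒯, ENNReal.ofReal (2 ^ Fintype.card ι * M) :=
          Finset.sum_le_sum fun B _ =>
            ENNReal.ofReal_le_ofReal (sum_exp_hitGap_swapPairs_le _ s p)
      _ ≤ S * ENNReal.ofReal (2 ^ Fintype.card ι * M) := by
          rw [Finset.sum_const, nsmul_eq_mul]
          gcongr
      _ = _ := by
          rw [ENNReal.ofReal_mul (by positivity), ENNReal.ofReal_mul (by positivity),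
            ENNReal.ofReal_pow (by norm_num), ENNReal.ofReal_natCast]
          simp only [ENNReal.ofReal_ofNat]
          ring
  have hsum : 2 ^ Fintype.card ι * ∫⁻ z, F z ∂ν ≤
      2 ^ Fintype.card ι * ENNReal.ofReal (S * M) :=
    calc 2 ^ Fintype.card ι * ∫⁻ z, F z ∂ν = ∑ ε : ι → Bool, ∫⁻ z, F (swapPairs ε z) ∂ν := by
          rw [Finset.sum_congr rfl fun ε _ => (measurePreserving_swapPairs μ ε).lintegral_comp hF]
          simp [Fintype.card_bool, ν]
      _ = ∫⁻ z, ∑ ε : ι → Bool, F (swapPairs ε z) ∂ν :=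
          (lintegral_finsetSum _ fun ε _ =>
            hF.comp (measurePreserving_swapPairs μ ε).measurable).symm
      _ ≤ ∫⁻ _z, 2 ^ Fintype.card ι * ENNReal.ofReal (S * M) ∂ν := lintegral_mono hpt
      _ = _ := by simp [ν]
  exact (ENNReal.mul_le_mul_iff_right (by simp) (by simp)).1 hsum

/-- A uniform lower tail in terms of the number of traces on a double sample. If some `A t` is
hit too rarely by the sample `x`, then `exp (s * hitGap (A t) (x, y))` is large on average over an
independent copy `y`; the exponential moment is balanced at `s = p / 2`. -/
theorem measure_exists_hits_le [Countable T] (μ : Measure E) [IsProbabilityMeasure μ]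
    {A : T → Set E} (hA : ∀ t, MeasurableSet (A t)) {S : ℕ}
    (hS : ∀ z : ι ⊕ ι → E, ∃ 𝒯 : Finset (Finset (ι ⊕ ι)), 𝒯.card ≤ S ∧
      ∀ t, ∃ B ∈ 𝒯, ∀ j, j ∈ B ↔ z j ∈ A t) {p : ℝ} (hp : 0 < p) (hpA : ∀ t, p ≤ μ.real (A t)) :
    (Measure.pi fun _ : ι => μ) {x | ∃ t, hits (A t) x ≤ p / 2 * Fintype.card ι} ≤
      ENNReal.ofReal (S * Real.exp (-(p ^ 2 / 8 * Fintype.card ι))) := by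
  set m : ℝ := (Fintype.card ι : ℝ)
  set π := Measure.pi fun _ : ι => μ
  let s := p / 2
  have hs : 0 < s := by positivity
  set f : (ι → E) → (ι → E) → ENNReal :=
    fun x y => ⨆ t, ENNReal.ofReal (Real.exp (s * (hits (A t) y - hits (A t) x)))
  have hf : Measurable (Function.uncurry f) := Measurable.iSup fun t =>
    (Real.measurable_exp.comp ((((measurable_hits (hA t)).comp measurable_snd).sub
      ((measurable_hits (hA t)).comp measurable_fst)).const_mul s)).ennreal_ofReal
  have hbound : ∫⁻ x, ∫⁻ y, f x y ∂π ∂π ≤ ENNReal.ofReal (S * Real.exp (s ^ 2 / 2 * m)) := by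
    rw [lintegral_lintegral hf.aemeasurable]
    change ∫⁻ q, Function.uncurry f q ∂(π.prod π) ≤ _
    rw [← (measurePreserving_arrowProdEquivProdArrow E E ι (fun _ => μ) (fun _ => μ)).lintegral_comp hf]
    exact lintegral_iSup_exp_hitGap_le μ hA hS s
  have hsub : {x | ∃ t, hits (A t) x ≤ p / 2 * m} ⊆
      {x | ENNReal.ofReal (Real.exp (s * (p / 2 * m))) ≤ ∫⁻ y, f x y ∂π} := by
    rintro x ⟨t, ht⟩
    calc ENNReal.ofReal (Real.exp (s * (p / 2 * m)))
        ≤ ENNReal.ofReal (∫ y, Real.exp (-(s * hits (A t) x)) * Real.exp (s * hits (A t) y) ∂π) := by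
          refine ENNReal.ofReal_le_ofReal ?_
          rw [integral_const_mul]
          refine le_trans ?_ (mul_le_mul_of_nonneg_left
            (exp_card_mul_le_integral_exp_hits μ (hA t) s) (Real.exp_nonneg _))
          rw [← Real.exp_add, Real.exp_le_exp]
          have h1 : s * hits (A t) x ≤ s * (p / 2 * m) := by gcongr
          have h2 : s * (m * p) ≤ s * (m * μ.real (A t)) := by gcongr; exact hpA t
          nlinarith
      _ ≤ ∫⁻ y, ENNReal.ofReal (Real.exp (-(s * hits (A t) x)) * Real.exp (s * hits (A t) y)) ∂π := by
          have hmeas : Measurable (hits (A t) : (ι → E) → ℝ) := measurable_hits (hA t)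
          rw [integral_eq_lintegral_of_nonneg_ae (.of_forall fun _ => by positivity)
            (by fun_prop)]
          exact ENNReal.ofReal_toReal_le
      _ ≤ ∫⁻ y, f x y ∂π := by
          refine lintegral_mono fun y => ?_
          rw [← Real.exp_add]
          refine le_trans (le_of_eq ?_) (le_iSup _ t)
          congr 2; ring
  have hmarkov := (meas_ge_le_lintegral_div (μ := π) (hf.lintegral_prod_right' (ν := π)).aemeasurable
    (ε := ENNReal.ofReal (Real.exp (s * (p / 2 * m)))) (by simp [Real.exp_pos]) (by simp))
  refine (measure_mono hsub).trans (hmarkov.trans ?_)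
  refine (ENNReal.div_le_div_right hbound _).trans ?_
  rw [← ENNReal.ofReal_div_of_pos (Real.exp_pos _)]
  refine ENNReal.ofReal_le_ofReal (le_of_eq ?_)
  rw [mul_div_assoc, ← Real.exp_sub]
  congr 2
  simp only [s]
  ring

end Symmetrization

/-! ### Slabs under the small-ball conditions -/

section Slabs

variable {E ι T : Type*} [NormedAddCommGroup E] [InnerProductSpace ℝ E]

theorem measurableSet_slabDiff [MeasurableSpace E] [BorelSpace E] (a b : ℝ) (t : E × E) :
    MeasurableSet (slabDiff a b t) := by
  have h : ∀ u : E, Measurable fun x : E => |⟪x, u⟫| := fun u =>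
    (continuous_id.inner continuous_const).abs.measurable
  exact (measurableSet_le (h t.1) measurable_const).inter
    (measurableSet_lt measurable_const (h t.2))

/-- With `m` points, `m` at least a constant multiple of the dimension, the number of traces of
`slabDiff` is absorbed into the exponential tail. The parameter `x = p ^ 2 / 128` in
`sum_choose_le_exp` makes the `2 * m`-dependent part of the logarithm of the count at most half of
`p ^ 2 / 8 * m`. -/
theorem measure_exists_hits_slabDiff_le [FiniteDimensional ℝ E] [MeasurableSpace E] [BorelSpace E]
    [Fintype ι] [Countable T] (μ : Measure E) [IsProbabilityMeasure μ] (a b : ℝ) (t : T → E × E)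
    {p : ℝ} (hp : 0 < p) (hp1 : p ≤ 1) (hpt : ∀ k, p ≤ μ.real (slabDiff a b (t k)))
    (hdim : 1 ≤ Module.finrank ℝ E)
    (hcard : 256 * Real.log (128 / p ^ 2) / p ^ 2 * Module.finrank ℝ E ≤ Fintype.card ι) :
    (Measure.pi fun _ : ι => μ)
        {x | ∃ k, hits (slabDiff a b (t k)) x ≤ p / 2 * Fintype.card ι} ≤
      ENNReal.ofReal (Real.exp (-(p ^ 2 / 32 * Fintype.card ι))) := by
  set n := Module.finrank ℝ E
  set N := ∑ k ∈ Finset.Iic (n + 1), (Fintype.card (ι ⊕ ι)).choose k with hN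
  have hp2 : p ^ 2 ≤ 1 := pow_le_one₀ hp.le hp1
  have hlog : 0 ≤ Real.log (128 / p ^ 2) :=
    Real.log_nonneg ((one_le_div (by positivity)).2 (by linarith))
  have hNle : (N : ℝ) ≤
      Real.exp ((n + 1) * Real.log (128 / p ^ 2) + p ^ 2 / 64 * Fintype.card ι) := by
    have h := sum_choose_le_exp (x := p ^ 2 / 128) (by positivity) (by linarith)
      (Fintype.card (ι ⊕ ι)) (n + 1)
    rw [inv_div] at h
    refine h.trans (Real.exp_le_exp.2 (le_of_eq ?_))
    rw [Fintype.card_sum]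
    push_cast
    ring
  refine (measure_exists_hits_le (S := N ^ 4) μ (A := fun k => slabDiff a b (t k))
    (fun k => measurableSet_slabDiff a b (t k)) (fun z => ?_) hp hpt).trans ?_
  · obtain ⟨𝒯, h𝒯, h⟩ := exists_slabDiff_traces a b z
    exact ⟨𝒯, h𝒯, fun k => h (t k)⟩
  · refine ENNReal.ofReal_le_ofReal ?_
    have hn : (1 : ℝ) ≤ n := by exact_mod_cast hdim
    have hbudget : 4 * ((n + 1) * Real.log (128 / p ^ 2)) ≤ p ^ 2 / 32 * Fintype.card ι := by
      have h := mul_le_mul_of_nonneg_left hcard (show 0 ≤ p ^ 2 / 32 by positivity)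
      have heq : p ^ 2 / 32 * (256 * Real.log (128 / p ^ 2) / p ^ 2 * n) =
          4 * ((n + n) * Real.log (128 / p ^ 2)) := by field_simp; ring
      rw [heq] at h
      refine le_trans ?_ h
      gcongr
    push_cast
    calc (N : ℝ) ^ 4 * Real.exp (-(p ^ 2 / 8 * Fintype.card ι))
        ≤ Real.exp ((n + 1) * Real.log (128 / p ^ 2) + p ^ 2 / 64 * Fintype.card ι) ^ 4 *
            Real.exp (-(p ^ 2 / 8 * Fintype.card ι)) := by gcongr
      _ ≤ _ := by
        rw [← Real.exp_nat_mul, ← Real.exp_add, Real.exp_le_exp]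
        push_cast
        linarith

/-- A finite sample that hits `slabDiff a (2 * b)` for the parameters in a dense set hits the
wider sets `slabDiff (2 * a) b` for all parameters, since finitely many strict inequalities are
stable under small changes of the parameters. -/
theorem exists_mem_dense_slabDiff_subset [Finite ι] {U : Set (E × E)} {D : Set U} (hD : Dense D)
    {a b : ℝ} (ha : 0 < a) (hb : 0 < b) (x : ι → E) {t : E × E} (ht : t ∈ U) :
    ∃ t' ∈ D, ∀ i, x i ∈ slabDiff a (2 * b) t'.1 → x i ∈ slabDiff (2 * a) b t := by
  let O : Set U := {t' | ∀ i, |⟪x i, t'.1.1 - t.1⟫| < a ∧ |⟪x i, t'.1.2 - t.2⟫| < b}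
  have hO : IsOpen O := by
    simp only [O, Set.ofPred_forall, Set.ofPred_and]
    refine isOpen_iInter_of_finite fun i => (isOpen_lt ?_ ?_).inter (isOpen_lt ?_ ?_) <;> fun_prop
  obtain ⟨t', ht'D, ht'O⟩ := hD.exists_mem_open hO ⟨⟨t, ht⟩, fun i => by simp [ha, hb]⟩
  refine ⟨t', ht'D, fun i hi => ?_⟩
  obtain ⟨h₁, h₂⟩ := ht'O i
  obtain ⟨h₃, h₄⟩ := hi
  rw [inner_sub_right] at h₁ h₂
  constructor
  · have := abs_sub_abs_le_abs_sub ⟪x i, t.1⟫ ⟪x i, t'.1.1⟫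
    rw [abs_sub_comm] at this
    linarith
  · have := abs_sub_abs_le_abs_sub ⟪x i, t'.1.2⟫ ⟪x i, t.2⟫
    show b < |⟪x i, t.2⟫|
    linarith

/-- On `slabDiff (lam / 2) b (u, w)`, with `w` the direction of `u - v`, clipping at the level `lam`
does not shrink the difference of `⟪x, u⟫` and `⟪x, v⟫` below a multiple of `‖u - v‖`. -/
theorem mul_norm_sub_le_abs_clip_sub_clip {lam b : ℝ} (hlam : 0 < lam) {u v x : E}
    (hu : ‖u‖ ≤ 1) (hv : ‖v‖ ≤ 1) (huv : u ≠ v)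
    (hx : x ∈ slabDiff (lam / 2) b (u, ‖u - v‖⁻¹ • (u - v))) :
    min b (lam / 4) * ‖u - v‖ ≤ |clip lam ⟪x, u⟫ - clip lam ⟪x, v⟫| := by
  have hr : 0 < ‖u - v‖ := norm_pos_iff.2 (sub_ne_zero.2 huv)
  have hr2 : ‖u - v‖ ≤ 2 := (norm_sub_le u v).trans (by linarith)
  refine le_trans (le_min ?_ ?_) (min_le_abs_clip_sub_clip hlam hx.1)
  · have h : b < |⟪x, ‖u - v‖⁻¹ • (u - v)⟫| := hx.2
    rw [inner_smul_right, abs_mul, abs_of_pos (inv_pos.2 hr), ← div_eq_inv_mul, lt_div_iff₀ hr,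
      inner_sub_right] at h
    exact (mul_le_mul_of_nonneg_right (min_le_left _ _) hr.le).trans h.le
  · calc min b (lam / 4) * ‖u - v‖ ≤ lam / 4 * ‖u - v‖ := by gcongr; exact min_le_right _ _
      _ ≤ lam / 4 * 2 := by gcongr
      _ = lam / 2 := by ring

/-- If every `slabDiff` is hit often, then clipping preserves a positive proportion of
`‖u - v‖ ^ 2` on average over the sample. -/
theorem mul_norm_sub_sq_le_mean_clip [Fintype ι] {lam b q : ℝ} (hlam : 0 < lam) (hb : 0 < b)
    (hι : 0 < Fintype.card ι) {x : ι → E}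
    (hx : ∀ u ∈ Metric.closedBall (0 : E) 1, ∀ w ∈ Metric.sphere (0 : E) 1,
      q * Fintype.card ι ≤ hits (slabDiff (lam / 2) b (u, w)) x)
    {u v : E} (hu : u ∈ Metric.closedBall (0 : E) 1) (hv : v ∈ Metric.closedBall (0 : E) 1) :
    q * min b (lam / 4) ^ 2 * ‖u - v‖ ^ 2 ≤
      (1 / (Fintype.card ι : ℝ)) * ∑ i, |clip lam ⟪x i, u⟫ - clip lam ⟪x i, v⟫| ^ 2 := by
  rcases eq_or_ne u v with rfl | huv
  · simp
  have hκ : 0 < min b (lam / 4) := lt_min hb (by positivity)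
  have hr : 0 < ‖u - v‖ := norm_pos_iff.2 (sub_ne_zero.2 huv)
  set w := ‖u - v‖⁻¹ • (u - v)
  have hw : w ∈ Metric.sphere (0 : E) 1 := by
    rw [mem_sphere_zero_iff_norm, norm_smul, norm_inv, norm_norm, inv_mul_cancel₀ hr.ne']
  rw [mem_closedBall_zero_iff] at hu hv
  have hm : (0 : ℝ) < Fintype.card ι := by exact_mod_cast hι
  rw [one_div, ← div_eq_inv_mul, le_div_iff₀ hm]
  calc q * min b (lam / 4) ^ 2 * ‖u - v‖ ^ 2 * Fintype.card ι
      = q * Fintype.card ι * (min b (lam / 4) * ‖u - v‖) ^ 2 := by ring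
    _ ≤ hits (slabDiff (lam / 2) b (u, w)) x * (min b (lam / 4) * ‖u - v‖) ^ 2 := by
        gcongr; exact hx u (mem_closedBall_zero_iff.2 hu) w hw
    _ = ∑ i, (slabDiff (lam / 2) b (u, w)).indicator 1 (x i) *
          (min b (lam / 4) * ‖u - v‖) ^ 2 := by rw [hits, Finset.sum_mul]
    _ ≤ _ := by
        refine Finset.sum_le_sum fun i _ => ?_
        by_cases hi : x i ∈ slabDiff (lam / 2) b (u, w)
        · rw [Set.indicator_of_mem hi, Pi.one_apply, one_mul]
          gcongr
          exact mul_norm_sub_le_abs_clip_sub_clip hlam hu hv huv hi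
        · rw [Set.indicator_of_notMem hi, zero_mul]
          positivity

/-- The reverse small-ball bound on the sphere carries over to the ball, because slabs only grow
when `u` is shortened, and the small-ball bound then removes at most half of the mass. -/
theorem le_measureReal_slabDiff [MeasurableSpace E] (μ : Measure E)
    [IsProbabilityMeasure μ] {a b ε : ℝ}
    (hlow : ∀ u ∈ Metric.sphere (0 : E) 1, ε ≤ μ.real {x | |⟪x, u⟫| ≤ a})
    (hup : ∀ w ∈ Metric.sphere (0 : E) 1, μ.real {x | |⟪x, w⟫| ≤ b} ≤ ε / 2)
    {u w : E} (hu : u ∈ Metric.closedBall (0 : E) 1) (hw : w ∈ Metric.sphere (0 : E) 1) :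
    ε / 2 ≤ μ.real (slabDiff a b (u, w)) := by
  have hball : ε ≤ μ.real {x | |⟪x, u⟫| ≤ a} := by
    obtain ⟨e, he, hue⟩ : ∃ e ∈ Metric.sphere (0 : E) 1, u = ‖u‖ • e := by
      rcases eq_or_ne u 0 with rfl | h0
      · exact ⟨w, hw, by simp⟩
      · have h := norm_ne_zero_iff.2 h0
        exact ⟨‖u‖⁻¹ • u, by simp [norm_smul, h], by simp [smul_smul, h]⟩
    refine (hlow e he).trans (measureReal_mono fun x hx => ?_)
    have hx' : |⟪x, e⟫| ≤ a := hx
    show |⟪x, u⟫| ≤ a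
    rw [hue, inner_smul_right, abs_mul, abs_norm]
    exact (mul_le_of_le_one_left (abs_nonneg _) (mem_closedBall_zero_iff.1 hu)).trans hx'
  have hsub : {x | |⟪x, u⟫| ≤ a} ⊆ slabDiff a b (u, w) ∪ {x | |⟪x, w⟫| ≤ b} := fun x hx =>
    (lt_or_ge b |⟪x, w⟫|).imp (fun h => ⟨hx, h⟩) id
  have h := (measureReal_mono hsub).trans (measureReal_union_le (μ := μ) _ _)
  linarith [hup w hw]

end Slabs

/-! ### Clipped random vectors -/

theorem theorem1p1 (V : Set RandomVector.{u}) (hV : StrongSmallBall V)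
    (hV' : ReverseSmallBall V) (lam : ℝ) (hlam : 0 < lam) :
    ∃ C c : ℝ, 0 < C ∧ 0 < c ∧
      ∀ X ∈ V, ∀ m : ℕ, C * (X.dim : ℝ) ≤ (m : ℝ) →
        ∀ (Ω' : Type v) [MeasurableSpace Ω'] (P : Measure Ω') [IsProbabilityMeasure P]
          (Y : Fin m → Ω' → EuclideanSpace ℝ (Fin X.dim)),
          iIndepFun Y P → (∀ i, IdentDistrib (Y i) X.toFun P X.prob) →
            1 - Real.exp (-(c * (m : ℝ))) ≤
              P.real {ω |
                ∀ u ∈ Metric.closedBall (0 : EuclideanSpace ℝ (Fin X.dim)) 1,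
                ∀ v ∈ Metric.closedBall (0 : EuclideanSpace ℝ (Fin X.dim)) 1,
                  c * ‖u - v‖ ^ 2 ≤
                    (1 / (m : ℝ)) *
                      ∑ i, |clip lam ⟪Y i ω, u⟫ - clip lam ⟪Y i ω, v⟫| ^ 2} := by
  obtain ⟨ε, hε, hlow⟩ := hV' (lam / 4) (by positivity)
  -- The small-ball level must not exceed `1`, also when `V` is empty.
  obtain ⟨ε, hε, hε1, hlow⟩ : ∃ ε : ℝ, 0 < ε ∧ ε ≤ 1 ∧ ∀ X ∈ V,
      ∀ u ∈ Metric.sphere (0 : EuclideanSpace ℝ (Fin X.dim)) 1,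
        ε ≤ X.prob.real {ω | |⟪X.toFun ω, u⟫| ≤ lam / 4} :=
    ⟨min ε 1, lt_min hε one_pos, min_le_right _ _, fun X hX u hu =>
      (min_le_left _ _).trans (hlow X hX u hu)⟩
  obtain ⟨δ, hδ, hup⟩ := hV (ε / 2) (by positivity)
  set p := ε / 2 with hp_def
  have hp : 0 < p := by positivity
  have hp1 : p ≤ 1 := by rw [hp_def]; linarith
  set κ := min (δ / 2) (lam / 4)
  have hκ : 0 < κ := lt_min (by positivity) (by positivity)
  have hlog : 0 < Real.log (128 / p ^ 2) := by
    have hp2 : p ^ 2 ≤ 1 := pow_le_one₀ hp.le hp1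
    exact Real.log_pos ((one_lt_div (by positivity)).2 (by linarith))
  refine ⟨256 * Real.log (128 / p ^ 2) / p ^ 2, min (p ^ 2 / 32) (p / 2 * κ ^ 2), by positivity,
    lt_min (by positivity) (by positivity), fun X hX m hm Ω' _ P _ Y hY hYX => ?_⟩
  set c := min (p ^ 2 / 32) (p / 2 * κ ^ 2)
  let F := EuclideanSpace ℝ (Fin X.dim)
  rcases Nat.eq_zero_or_pos X.dim with hdim | hdim
  · -- In dimension zero the two vectors coincide.
    have : IsEmpty (Fin X.dim) := by rw [hdim]; infer_instance
    rw [show {ω | _} = (Set.univ : Set Ω') from Set.eq_univ_of_forall fun ω u _ v _ => by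
      rw [Subsingleton.elim u v]; simp]
    simpa using Real.exp_nonneg _
  have hm0 : 0 < m := by
    have : (0 : ℝ) < m := lt_of_lt_of_le (by positivity) hm
    exact_mod_cast this
  let μ : Measure F := X.prob.map X.toFun
  have : IsProbabilityMeasure μ := Measure.isProbabilityMeasure_map X.measurable_toFun.aemeasurable
  have hYae : ∀ i, AEMeasurable (Y i) P := fun i => (hYX i).aemeasurable_fst
  have hlaw : P.map (fun ω i => Y i ω) = Measure.pi fun _ : Fin m => μ := by
    rw [(iIndepFun_iff_map_fun_eq_pi_map hYae).1 hY]
    exact congrArg _ (funext fun i => (hYX i).map_eq)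
  have hreal : ∀ (u : F) (r : ℝ), μ.real {x | |⟪x, u⟫| ≤ r} =
      X.prob.real {ω | |⟪X.toFun ω, u⟫| ≤ r} := fun u r =>
    map_measureReal_apply X.measurable_toFun
      (measurableSet_le (continuous_id.inner continuous_const).abs.measurable measurable_const)
  let U : Set (F × F) := Metric.closedBall 0 1 ×ˢ Metric.sphere 0 1
  obtain ⟨D, hDc, hD⟩ := TopologicalSpace.exists_countable_dense U
  have : Countable D := hDc.to_subtype
  have hmass : ∀ k : D, p ≤ μ.real (slabDiff (lam / 4) δ k.1.1) := fun k =>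
    le_measureReal_slabDiff μ (fun u hu => (hlow X hX u hu).trans_eq (hreal u _).symm)
      (fun w hw => (hreal w _).trans_le (hup X hX w hw)) k.1.2.1 k.1.2.2
  let bad : Set (Fin m → F) :=
    {x | ∃ k : D, hits (slabDiff (lam / 4) δ k.1.1) x ≤ p / 2 * Fintype.card (Fin m)}
  have hbad_meas : MeasurableSet bad := by
    simp only [bad, Set.ofPred_exists]
    exact MeasurableSet.iUnion fun k =>
      measurableSet_le (measurable_hits (measurableSet_slabDiff _ _ _)) measurable_const
  have hbad : P.real ((fun ω i => Y i ω) ⁻¹' bad) ≤ Real.exp (-(p ^ 2 / 32 * m)) := by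
    have h := measure_exists_hits_slabDiff_le (ι := Fin m) μ (lam / 4) δ (fun k : D => k.1.1)
      hp hp1 hmass (by simpa [F] using Nat.succ_le_of_lt hdim) (by simpa [F] using hm)
    rw [Fintype.card_fin] at h
    refine ENNReal.toReal_le_of_le_ofReal (Real.exp_nonneg _) ?_
    rw [← Measure.map_apply_of_aemeasurable (aemeasurable_pi_lambda _ hYae) hbad_meas, hlaw]
    simpa [bad] using h
  set good := {ω | ∀ u ∈ Metric.closedBall (0 : F) 1, ∀ v ∈ Metric.closedBall (0 : F) 1,
    c * ‖u - v‖ ^ 2 ≤ (1 / (m : ℝ)) * ∑ i, |clip lam ⟪Y i ω, u⟫ - clip lam ⟪Y i ω, v⟫| ^ 2}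
  have hcover : (Set.univ : Set Ω') ⊆ good ∪ (fun ω i => Y i ω) ⁻¹' bad := by
    intro ω _
    by_cases hω : (fun i => Y i ω) ∈ bad
    · exact Or.inr hω
    refine Or.inl fun u hu v hv => ?_
    have hhits : ∀ u ∈ Metric.closedBall (0 : F) 1, ∀ w ∈ Metric.sphere (0 : F) 1,
        p / 2 * Fintype.card (Fin m) ≤
          hits (slabDiff (lam / 2) (δ / 2) (u, w)) (fun i => Y i ω) := by
      intro u hu w hw
      obtain ⟨k, hk, hsub⟩ := exists_mem_dense_slabDiff_subset hD (a := lam / 4) (b := δ / 2)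
        (by positivity) (by positivity) (fun i => Y i ω) (t := (u, w)) ⟨hu, hw⟩
      rw [show 2 * (lam / 4) = lam / 2 by ring, show 2 * (δ / 2) = δ by ring] at hsub
      have hk' : ¬ hits (slabDiff (lam / 4) δ k.1) (fun i => Y i ω) ≤ p / 2 * Fintype.card (Fin m) :=
        fun h => hω ⟨⟨k, hk⟩, h⟩
      exact (not_le.1 hk').le.trans (hits_mono hsub)
    have h := mul_norm_sub_sq_le_mean_clip hlam (half_pos hδ) (by simpa using hm0) hhits hu hv
    rw [Fintype.card_fin] at h
    exact (mul_le_mul_of_nonneg_right (min_le_right _ _) (sq_nonneg _)).trans h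
  have htotal : 1 ≤ P.real good + P.real ((fun ω i => Y i ω) ⁻¹' bad) := by
    have h := (measureReal_mono hcover).trans (measureReal_union_le (μ := P) _ _)
    simpa using h
  have hexp : Real.exp (-(p ^ 2 / 32 * m)) ≤ Real.exp (-(c * m)) := by
    rw [Real.exp_le_exp, neg_le_neg_iff]
    exact mul_le_mul_of_nonneg_right (min_le_left _ _) (Nat.cast_nonneg m)
  linarith
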